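/- Let $d\ge 2$, $\lambda\in[0,1]$, $\gamma>0$ and $h\ge 0$. Let $\mathbb H^d$ be $d$-dimensional hyperbolic space of curvature $-1$ in the Poincaré ball model on the open unit ball $\mathbb B^d$ with boundary $\mathbb S^{d-1}$, and let $o$ be the centre of the ball. A $\lambda$-geodesic hyperplane is a nonempty set $H=S\cap\mathbb B^d$, where $S$ is a Euclidean sphere or hyperplane that meets $\mathbb S^{d-1}$ at the angle $\theta\in[0,\pi/2]$ with $\cos\theta=\lambda$ (equivalently, a complete totally umbilical hypersurface of normal curvature $\lambda$). Let $\mathrm{Hyp}_\lambda^o$ be the set of those $\lambda$-geodesic hyperplanes $H$ with $o\notin H$ for which some connected component of $\mathbb B^d\setminus H$ is geodesically convex and does not contain $o$ (that is, $o$ lies on the non-convex side of $H$; for $\lambda=0$ this just says $o\notin H$). For $s>0$ and $u\in\mathbb S^{d-1}$ let $H_h(s,u)\in\mathrm{Hyp}_\lambda^o$ be the $\lambda$-geodesic hyperplane at hyperbolic distance $s$ from $o$ whose nearest point to $o$ lies in direction $u$; explicitly, with $r=\tanh(s/2)$ and $R=\frac{1-r^2}{2(\lambda+r)}$, it is the intersection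 of $\mathbb B^d$ with the Euclidean sphere of radius $R$ centred at $(r+R)u$. Let $\sigma_{d-1}$ be the normalised surface measure on $\mathbb S^{d-1}$, and let $\mu_{\gamma,\lambda}$ be the measure on $\mathrm{Hyp}_\lambda^o$ given by $$\mu_{\gamma,\lambda}(\,\cdot\,)=\gamma\int_0^\infty\int_{\mathbb S^{d-1}}\mathbf 1\{H_h(s,u)\in\,\cdot\,\}\,(\cosh s+\lambda\sinh s)^{d-1}\,\sigma_{d-1}(\mathrm du)\,\mathrm ds .$$ Let $\ell(h)$ be any hyperbolic geodesic segment of length $h$ starting at $o$, and let $[\ell(h)]_\lambda=\{H\in\mathrm{Hyp}_\lambda^o: H\cap\ell(h)\ne\varnothing\}$. Then $$\mu_{\gamma,\lambda}([\ell(h)]_\lambda)=\gamma\,\frac{\Gamma(\frac d2)}{2\sqrt\pi\,\Gamma(\frac{d+1}2)}\,h .$$ In particular, the measure is linear in $h$ and does not depend on $\lambda$. -/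

import Mathlib

open Set Metric MeasureTheory

open scoped RealInnerProductSpace ENNReal

namespace LambdaGeod

/-- Euclidean `d`-space, the ambient space of the Poincaré ball model. -/
abbrev E (d : ℕ) : Type := EuclideanSpace ℝ (Fin d)

/-- The open unit ball `𝔹^d`, the underlying space of the Poincaré ball model of `ℍ^d`.
The origin `o` of `ℍ^d` is its centre `0`. -/
abbrev unitBall (d : ℕ) : Set (E d) := ball (0 : E d) 1

/-- The hyperbolic distance of the Poincaré ball model (curvature `-1`). -/
noncomputable def poincareDist {d : ℕ} (x y : E d) : ℝ :=
  Real.arcosh (1 + 2 * ‖x - y‖ ^ 2 / ((1 - ‖x‖ ^ 2) * (1 - ‖y‖ ^ 2)))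

/-- `ℓ` is a hyperbolic geodesic segment of length `h` from `x` to `y`: the image of `[0, h]` under
a curve in the ball which is isometric for the hyperbolic distance. -/
def IsGeodesicSegment {d : ℕ} (x y : E d) (h : ℝ) (ℓ : Set (E d)) : Prop :=
  0 ≤ h ∧ ∃ c : ℝ → E d,
    (∀ t ∈ Icc 0 h, c t ∈ unitBall d) ∧
    (∀ s ∈ Icc 0 h, ∀ t ∈ Icc 0 h, poincareDist (c s) (c t) = |s - t|) ∧
    c 0 = x ∧ c h = y ∧ ℓ = c '' Icc 0 h

/-- Geodesic convexity in the Poincaré ball model. -/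
def IsHypConvex {d : ℕ} (K : Set (E d)) : Prop :=
  K ⊆ unitBall d ∧ ∀ x ∈ K, ∀ y ∈ K, ∀ (h : ℝ) (ℓ : Set (E d)), IsGeodesicSegment x y h ℓ → ℓ ⊆ K

/-- `H` is a `λ`-geodesic hyperplane: a nonempty set `S ∩ 𝔹^d`, where `S` is a Euclidean sphere or
a Euclidean hyperplane that meets the unit sphere, and does so at an angle `θ` with `cos θ = λ`.
The angle between two hypersurfaces is the one in `[0, π / 2]` between their normal lines. -/
def IsLambdaGeodesic {d : ℕ} (lam : ℝ) (H : Set (E d)) : Prop :=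
  H.Nonempty ∧
  ((∃ (c : E d) (R : ℝ), 0 < R ∧ H = sphere c R ∩ unitBall d ∧
      (sphere c R ∩ sphere 0 1).Nonempty ∧
      ∀ x ∈ sphere c R ∩ sphere 0 1, |Real.cos (InnerProductGeometry.angle x (x - c))| = lam) ∨
   (∃ (n : E d) (t : ℝ), n ≠ 0 ∧ H = {x | ⟪n, x⟫ = t} ∩ unitBall d ∧
      ({x | ⟪n, x⟫ = t} ∩ sphere 0 1).Nonempty ∧
      ∀ x ∈ {x | ⟪n, x⟫ = t} ∩ sphere 0 1, |Real.cos (InnerProductGeometry.angle x n)| = lam))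

/-- The hypersurface `H` does not contain `o`, and `o` is not on its convex side: some connected
component of the complement of `H` is geodesically convex and does not contain `o`. -/
def OriginOnNonconvexSide {d : ℕ} (H : Set (E d)) : Prop :=
  (0 : E d) ∉ H ∧ ∃ x ∈ unitBall d \ H,
    IsHypConvex (connectedComponentIn (unitBall d \ H) x) ∧
      (0 : E d) ∉ connectedComponentIn (unitBall d \ H) x

/-- The space of `λ`-geodesic hyperplanes with `o` on the non-convex side. For `λ = 0` both sides
are convex, and these are the totally geodesic hyperplanes that do not contain `o`. -/
def HypO (d : ℕ) (lam : ℝ) : Type :=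
  {H : Set (E d) // IsLambdaGeodesic lam H ∧ OriginOnNonconvexSide H}

/-- The hyperplanes in `HypO d lam` that hit the set `A`. -/
def hitting {d : ℕ} (lam : ℝ) (A : Set (E d)) : Set (HypO d lam) :=
  {H | (H.1 ∩ A).Nonempty}

/-- The Borel σ-algebra of the space of (relatively) closed subsets of `ℍ^d`, generated by the
families of sets that hit a given compact set, on `HypO d lam`. -/
instance instMeasurableSpaceHypO (d : ℕ) (lam : ℝ) : MeasurableSpace (HypO d lam) :=
  MeasurableSpace.generateFrom
    {F | ∃ C : Set (E d), IsCompact C ∧ C ⊆ unitBall d ∧ F = hitting lam C}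

/-- The Euclidean distance to the centre of a point at hyperbolic distance `s` from it. -/
noncomputable def eucRadius (s : ℝ) : ℝ := Real.tanh (s / 2)

/-- The Euclidean radius of the sphere which carries a `λ`-geodesic hyperplane at hyperbolic
distance `s` from `o`, with `o` on its non-convex side. -/
noncomputable def sphereRadius (lam s : ℝ) : ℝ :=
  (1 - eucRadius s ^ 2) / (2 * (lam + eucRadius s))

/-- The `λ`-geodesic hyperplane at hyperbolic distance `s > 0` from `o` in the direction `u`. -/
noncomputable def hyperplaneSet {d : ℕ} (lam s : ℝ) (u : E d) : Set (E d) :=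
  sphere ((eucRadius s + sphereRadius lam s) • u) (sphereRadius lam s) ∩ unitBall d

section Aux

variable {d : ℕ}

theorem eucRadius_pos {s : ℝ} (hs : 0 < s) : 0 < eucRadius s := by
  unfold eucRadius
  rw [Real.tanh_eq_sinh_div_cosh]
  exact div_pos (Real.sinh_pos_iff.2 (by linarith)) (Real.cosh_pos _)

theorem eucRadius_lt_one (s : ℝ) : eucRadius s < 1 := Real.tanh_lt_one _

theorem sphereRadius_pos {lam s : ℝ} (hl : 0 ≤ lam) (hs : 0 < s) : 0 < sphereRadius lam s := by
  have h0 := eucRadius_pos hs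
  have h1 := eucRadius_lt_one s
  unfold sphereRadius
  apply div_pos <;> nlinarith

/-- The law of cosines that expresses the angle with the unit sphere. -/
theorem sphereRadius_eq {lam s : ℝ} (hl : 0 ≤ lam) (hs : 0 < s) :
    sphereRadius lam s ^ 2 + 1 - (eucRadius s + sphereRadius lam s) ^ 2
      = 2 * sphereRadius lam s * lam := by
  have h0 := eucRadius_pos hs
  have : lam + eucRadius s ≠ 0 := by positivity
  unfold sphereRadius
  field_simp
  ring

theorem norm_sub_smul_sq (x u : E d) (hu : ‖u‖ = 1) (p : ℝ) :
    ‖x - p • u‖ ^ 2 = ‖x‖ ^ 2 - 2 * p * ⟪x, u⟫ + p ^ 2 := by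
  rw [norm_sub_sq_real, inner_smul_right, norm_smul, hu, mul_one, Real.norm_eq_abs, sq_abs]
  ring

theorem exists_unit_perp (hd : 2 ≤ d) (u : E d) (hu : ‖u‖ = 1) :
    ∃ w : E d, ‖w‖ = 1 ∧ ⟪u, w⟫ = 0 := by
  have h1 : Module.finrank ℝ (ℝ ∙ u)ᗮ + 1 = d := by
    have h2 := Submodule.finrank_add_finrank_orthogonal (ℝ ∙ u)
    rw [finrank_span_singleton (by intro h; simp [h] at hu), finrank_euclideanSpace_fin] at h2
    omega
  have : Nontrivial (ℝ ∙ u)ᗮ := Module.nontrivial_of_finrank_pos (R := ℝ) (by omega)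
  obtain ⟨w, hw⟩ := exists_ne (0 : (ℝ ∙ u)ᗮ)
  have hw0 : (w : E d) ≠ 0 := by simpa using hw
  refine ⟨‖(w : E d)‖⁻¹ • (w : E d), ?_, ?_⟩
  · rw [norm_smul, norm_inv, norm_norm, inv_mul_cancel₀ (norm_ne_zero_iff.2 hw0)]
  · rw [inner_smul_right, Submodule.mem_orthogonal_singleton_iff_inner_right.1 w.2, mul_zero]

/-- A point of the hyperplane nearest to `o` lies in direction `u`, at hyperbolic distance `s`. -/
theorem hyperplaneSet_nearest {lam s : ℝ} (hl : 0 ≤ lam) (hs : 0 < s) {u : E d} (hu : ‖u‖ = 1) :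
    eucRadius s • u ∈ hyperplaneSet lam s u ∧ poincareDist 0 (eucRadius s • u) = s ∧
      ∀ x ∈ hyperplaneSet lam s u, eucRadius s ≤ ‖x‖ := by
  have h0 := eucRadius_pos hs
  have h1 := eucRadius_lt_one s
  have hR := sphereRadius_pos hl hs
  refine ⟨⟨?_, ?_⟩, ?_, ?_⟩
  · rw [mem_sphere, dist_eq_norm, ← sub_smul, norm_smul, hu, mul_one, Real.norm_eq_abs]
    rw [show eucRadius s - (eucRadius s + sphereRadius lam s) = - sphereRadius lam s by ring,
      abs_neg, abs_of_pos hR]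
  · rw [mem_ball_zero_iff, norm_smul, hu, mul_one, Real.norm_eq_abs, abs_of_pos h0]
    exact h1
  · refine Eq.trans ?_ (Real.arcosh_cosh hs.le)
    unfold poincareDist
    congr 1
    rw [zero_sub, norm_neg, norm_smul, hu, mul_one, norm_zero, Real.norm_eq_abs, sq_abs]
    have h3 : Real.cosh s = Real.cosh (s / 2) ^ 2 + Real.sinh (s / 2) ^ 2 := by
      rw [← Real.cosh_two_mul]; congr 1; ring
    have h4 := Real.cosh_sq (s / 2)
    have h5 := Real.cosh_pos (s / 2)
    have h6 : 1 - eucRadius s ^ 2 ≠ 0 := by nlinarith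
    have h7 : 1 - eucRadius s ^ 2 = 1 / Real.cosh (s / 2) ^ 2 := by
      unfold eucRadius
      rw [Real.tanh_eq_sinh_div_cosh]
      field_simp
      linarith
    rw [h7]
    unfold eucRadius
    rw [Real.tanh_eq_sinh_div_cosh, h3]
    field_simp
    linarith
  · rintro x ⟨hx, -⟩
    rw [mem_sphere, dist_eq_norm] at hx
    have h2 := norm_sub_norm_le ((eucRadius s + sphereRadius lam s) • u) x
    rw [norm_sub_rev, hx, norm_smul, hu, mul_one, Real.norm_eq_abs, abs_of_pos (by positivity)] at h2
    linarith

theorem isLambdaGeodesic_hyperplaneSet (hd : 2 ≤ d) {lam s : ℝ} (hl : lam ∈ Icc (0 : ℝ) 1)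
    (hs : 0 < s) {u : E d} (hu : ‖u‖ = 1) : IsLambdaGeodesic lam (hyperplaneSet lam s u) := by
  refine ⟨⟨_, (hyperplaneSet_nearest hl.1 hs hu).1⟩, Or.inl ⟨_, _, sphereRadius_pos hl.1 hs, rfl,
    ?_, ?_⟩⟩
  · obtain ⟨w, hw, huw⟩ := exists_unit_perp hd u hu
    have h0 := eucRadius_pos hs
    have h1 := eucRadius_lt_one s
    have hR := sphereRadius_pos hl.1 hs
    have he := sphereRadius_eq hl.1 hs
    set R := sphereRadius lam s
    set r := eucRadius s
    set p := r + R with hp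
    have hp0 : 0 < p := by positivity
    have hRle : 1 - r ≤ 2 * R := by
      have : R * (2 * (lam + r)) = 1 - r ^ 2 := by
        have : lam + r ≠ 0 := by have := hl.1; positivity
        change (1 - r ^ 2) / (2 * (lam + r)) * (2 * (lam + r)) = 1 - r ^ 2
        field_simp
      have h3 := hl.2
      nlinarith
    set a := (1 + p ^ 2 - R ^ 2) / (2 * p) with ha
    have hap : 2 * p * a = 1 + p ^ 2 - R ^ 2 := by rw [ha]; field_simp
    have ha0 : 0 ≤ a := by
      rw [ha]; apply div_nonneg <;> nlinarith
    have ha1 : a ≤ 1 := by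
      rw [ha, div_le_one (by positivity)]
      nlinarith
    have hx : ‖a • u + √(1 - a ^ 2) • w‖ ^ 2 = 1 := by
      rw [norm_add_sq_real, norm_smul, norm_smul, inner_smul_left, inner_smul_right, huw, hu, hw]
      simp only [mul_one, mul_zero, Real.norm_eq_abs, sq_abs]
      rw [Real.sq_sqrt (by nlinarith)]
      ring
    refine ⟨a • u + √(1 - a ^ 2) • w, ?_, ?_⟩
    · rw [mem_sphere, dist_eq_norm, ← sq_eq_sq₀ (norm_nonneg _) hR.le, norm_sub_smul_sq _ _ hu, hx,
        inner_add_left, inner_smul_left, inner_smul_left, real_inner_self_eq_norm_sq, hu,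
        real_inner_comm, huw]
      simp only [RCLike.conj_to_real]
      linarith
    · rw [mem_sphere_zero_iff_norm, ← sq_eq_sq₀ (norm_nonneg _) zero_le_one, hx, one_pow]
  · rintro x ⟨hx, hx1⟩
    have hR := sphereRadius_pos hl.1 hs
    have he := sphereRadius_eq hl.1 hs
    rw [mem_sphere, dist_eq_norm] at hx
    rw [mem_sphere_zero_iff_norm] at hx1
    have h2 := norm_sub_smul_sq x u hu (eucRadius s + sphereRadius lam s)
    rw [hx, hx1] at h2
    rw [InnerProductGeometry.cos_angle, hx, hx1, inner_sub_right, inner_smul_right,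
      real_inner_self_eq_norm_sq, hx1]
    rw [show (1 : ℝ) ^ 2 - (eucRadius s + sphereRadius lam s) * ⟪x, u⟫ = sphereRadius lam s * lam by
      linarith]
    rw [one_mul, mul_div_cancel_left₀ _ hR.ne', abs_of_nonneg hl.1]

/-- The convex side of `hyperplaneSet lam s u`. -/
noncomputable def convexSide (lam s : ℝ) (u : E d) : Set (E d) :=
  ball ((eucRadius s + sphereRadius lam s) • u) (sphereRadius lam s) ∩ unitBall d

theorem cosh_poincareDist {x y : E d} (hx : x ∈ unitBall d) (hy : y ∈ unitBall d) :
    Real.cosh (poincareDist x y)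
      = 1 + 2 * ‖x - y‖ ^ 2 / ((1 - ‖x‖ ^ 2) * (1 - ‖y‖ ^ 2)) := by
  rw [mem_ball_zero_iff] at hx hy
  have h1 : 0 < 1 - ‖x‖ ^ 2 := by nlinarith [norm_nonneg x]
  have h2 : 0 < 1 - ‖y‖ ^ 2 := by nlinarith [norm_nonneg y]
  refine Real.cosh_arcosh ?_
  have : 0 ≤ 2 * ‖x - y‖ ^ 2 / ((1 - ‖x‖ ^ 2) * (1 - ‖y‖ ^ 2)) := by positivity
  linarith

/-- Time coordinate of a point of the ball in the hyperboloid model. -/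
noncomputable def timeCoord (x : E d) : ℝ := (1 + ‖x‖ ^ 2) / (1 - ‖x‖ ^ 2)

/-- Space coordinate of a point of the ball in the hyperboloid model. -/
noncomputable def spaceCoord (x : E d) : E d := (2 / (1 - ‖x‖ ^ 2)) • x

theorem cosh_poincareDist' {x y : E d} (hx : x ∈ unitBall d) (hy : y ∈ unitBall d) :
    Real.cosh (poincareDist x y)
      = timeCoord x * timeCoord y - ⟪spaceCoord x, spaceCoord y⟫ := by
  rw [cosh_poincareDist hx hy]
  rw [mem_ball_zero_iff] at hx hy
  have h1 : 1 - ‖x‖ ^ 2 ≠ 0 := by nlinarith [norm_nonneg x]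
  have h2 : 1 - ‖y‖ ^ 2 ≠ 0 := by nlinarith [norm_nonneg y]
  unfold timeCoord spaceCoord
  rw [inner_smul_left, inner_smul_right, norm_sub_sq_real]
  simp only [RCLike.conj_to_real]
  field_simp
  ring

theorem timeCoord_sq {x : E d} (hx : x ∈ unitBall d) :
    timeCoord x ^ 2 = 1 + ⟪spaceCoord x, spaceCoord x⟫ := by
  rw [mem_ball_zero_iff] at hx
  have h1 : 1 - ‖x‖ ^ 2 ≠ 0 := by nlinarith [norm_nonneg x]
  unfold timeCoord spaceCoord
  rw [inner_smul_left, inner_smul_right, real_inner_self_eq_norm_sq]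
  simp only [RCLike.conj_to_real]
  field_simp
  ring

theorem hyperboloid_combination {x y z : E d} (hx : x ∈ unitBall d) (hy : y ∈ unitBall d)
    (hz : z ∈ unitBall d) {a b : ℝ} (hxz : poincareDist x z = a) (hzy : poincareDist z y = b)
    (hxy : poincareDist x y = a + b) :
    Real.sinh (a + b) * timeCoord z = Real.sinh b * timeCoord x + Real.sinh a * timeCoord y ∧
    Real.sinh (a + b) • spaceCoord z
      = Real.sinh b • spaceCoord x + Real.sinh a • spaceCoord y := by
  have e1 := cosh_poincareDist' hx hz
  have e2 := cosh_poincareDist' hz hy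
  have e3 := cosh_poincareDist' hx hy
  rw [hxz] at e1
  rw [hzy] at e2
  rw [hxy] at e3
  have ex := timeCoord_sq hx
  have ey := timeCoord_sq hy
  have ez := timeCoord_sq hz
  have sa := Real.sinh_add a b
  have ca := Real.cosh_add a b
  have qa := Real.cosh_sq a
  have qb := Real.cosh_sq b
  set S := Real.sinh (a + b)
  set W0 := S * timeCoord z - Real.sinh b * timeCoord x - Real.sinh a * timeCoord y with hW0
  set W := S • spaceCoord z - Real.sinh b • spaceCoord x - Real.sinh a • spaceCoord y with hW
  have k1 : W0 * timeCoord z = ⟪W, spaceCoord z⟫ := by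
    rw [hW, inner_sub_left, inner_sub_left, inner_smul_left, inner_smul_left, inner_smul_left,
      real_inner_comm (spaceCoord z) (spaceCoord y)]
    simp only [RCLike.conj_to_real]
    rw [hW0]
    linear_combination S * ez - Real.sinh b * (-e1) + Real.sinh a * e2 + sa
  have k2 : W0 ^ 2 = ‖W‖ ^ 2 := by
    rw [← real_inner_self_eq_norm_sq, hW]
    simp only [inner_sub_left, inner_sub_right, inner_smul_left, inner_smul_right,
      RCLike.conj_to_real]
    rw [real_inner_comm (spaceCoord x) (spaceCoord z), real_inner_comm (spaceCoord z) (spaceCoord y),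
      real_inner_comm (spaceCoord x) (spaceCoord y)]
    linear_combination S ^ 2 * ez + Real.sinh b ^ 2 * ex + Real.sinh a ^ 2 * ey
      + 2 * S * Real.sinh b * e1 + 2 * S * Real.sinh a * e2 - 2 * Real.sinh a * Real.sinh b * e3
      + (S - (Real.sinh a * Real.cosh b + Real.cosh a * Real.sinh b)) * sa
      + 2 * Real.sinh a * Real.sinh b * ca - Real.sinh b ^ 2 * qa - Real.sinh a ^ 2 * qb
  have k3 : W0 = 0 := by
    have c := abs_real_inner_le_norm W (spaceCoord z)
    rw [← k1] at c
    have c2 : (W0 * timeCoord z) ^ 2 ≤ ‖W‖ ^ 2 * ‖spaceCoord z‖ ^ 2 := by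
      rw [← mul_pow, ← sq_abs]
      gcongr
    rw [real_inner_self_eq_norm_sq] at ez
    rw [mul_pow, ← k2, ez, mul_add, mul_one] at c2
    have c3 : W0 ^ 2 ≤ 0 := by
      clear_value W0 W S
      linarith
    exact pow_eq_zero_iff two_ne_zero |>.1 (le_antisymm c3 (sq_nonneg W0))
  have k4 : W = 0 := by
    rw [k3] at k2
    have : ‖W‖ ^ 2 = 0 := by rw [← k2]; norm_num
    exact norm_eq_zero.1 (pow_eq_zero_iff two_ne_zero |>.1 this)
  refine ⟨by rw [hW0, sub_sub, sub_eq_zero] at k3; exact k3, ?_⟩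
  rw [hW, sub_sub, sub_eq_zero] at k4
  exact k4

theorem mem_convexSide_iff {lam s : ℝ} (hl : 0 ≤ lam) (hs : 0 < s) {u : E d} (hu : ‖u‖ = 1)
    {x : E d} (hx : x ∈ unitBall d) :
    x ∈ convexSide lam s u ↔
      (1 - sphereRadius lam s * lam) * timeCoord x
        - (eucRadius s + sphereRadius lam s) * ⟪spaceCoord x, u⟫ < sphereRadius lam s * lam := by
  have hR := sphereRadius_pos hl hs
  have he := sphereRadius_eq hl hs
  have hx' := hx
  rw [mem_ball_zero_iff] at hx'
  have h1 : 0 < 1 - ‖x‖ ^ 2 := by nlinarith [norm_nonneg x]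
  rw [convexSide, mem_inter_iff, and_iff_left hx, mem_ball, dist_eq_norm,
    ← sq_lt_sq₀ (norm_nonneg _) hR.le, norm_sub_smul_sq x u hu, timeCoord, spaceCoord,
    inner_smul_left]
  simp only [RCLike.conj_to_real]
  rw [← mul_lt_mul_iff_left₀ (b := _ - _) h1]
  have : ((1 - sphereRadius lam s * lam) * ((1 + ‖x‖ ^ 2) / (1 - ‖x‖ ^ 2)) -
      (eucRadius s + sphereRadius lam s) * (2 / (1 - ‖x‖ ^ 2) * ⟪x, u⟫)) * (1 - ‖x‖ ^ 2)
      = (1 - sphereRadius lam s * lam) * (1 + ‖x‖ ^ 2) -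
      (eucRadius s + sphereRadius lam s) * 2 * ⟪x, u⟫ := by
    field_simp
  rw [this]
  constructor <;> intro h <;> nlinarith

theorem isHypConvex_convexSide {lam s : ℝ} (hl : 0 ≤ lam) (hs : 0 < s) {u : E d} (hu : ‖u‖ = 1) :
    IsHypConvex (convexSide lam s u) := by
  refine ⟨inter_subset_right, ?_⟩
  rintro x hx y hy h ℓ ⟨hh, c, hc, hdist, rfl, rfl, rfl⟩
  rintro _ ⟨t, ht, rfl⟩
  rcases eq_or_lt_of_le hh with rfl | hpos
  · obtain rfl : t = 0 := le_antisymm ht.2 ht.1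
    exact hx
  have m0 : (0 : ℝ) ∈ Icc 0 h := ⟨le_rfl, hh⟩
  have mh : h ∈ Icc 0 h := ⟨hh, le_rfl⟩
  have d1 := hdist 0 m0 t ht
  have d2 := hdist t ht h mh
  have d3 := hdist 0 m0 h mh
  rw [zero_sub, abs_neg, abs_of_nonneg ht.1] at d1
  rw [abs_sub_comm, abs_of_nonneg (sub_nonneg.2 ht.2)] at d2
  rw [zero_sub, abs_neg, abs_of_nonneg hh] at d3
  obtain ⟨g1, g2⟩ := hyperboloid_combination (hc 0 m0) (hc h mh) (hc t ht) d1 d2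
    (by rw [d3]; ring)
  rw [mem_convexSide_iff hl hs hu (hc _ m0)] at hx
  rw [mem_convexSide_iff hl hs hu (hc _ mh)] at hy
  rw [mem_convexSide_iff hl hs hu (hc _ ht)]
  have g3 := congrArg (fun v => ⟪v, u⟫) g2
  simp only [inner_add_left, inner_smul_left, RCLike.conj_to_real] at g3
  have hth : t + (h - t) = h := by ring
  rw [hth] at g1 g3
  have sadd := Real.sinh_add t (h - t)
  rw [hth] at sadd
  have s1 : 0 ≤ Real.sinh t := Real.sinh_nonneg_iff.2 ht.1
  have s2 : 0 ≤ Real.sinh (h - t) := Real.sinh_nonneg_iff.2 (sub_nonneg.2 ht.2)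
  have s3 : 0 < Real.sinh h := Real.sinh_pos_iff.2 hpos
  have c1 := Real.one_le_cosh t
  have c2 := Real.one_le_cosh (h - t)
  have hsum : Real.sinh t + Real.sinh (h - t) ≤ Real.sinh h := by
    rw [sadd]; nlinarith
  have hT : 0 ≤ sphereRadius lam s * lam := mul_nonneg (sphereRadius_pos hl hs).le hl
  generalize sphereRadius lam s * lam = T at *
  generalize eucRadius s + sphereRadius lam s = p at *
  refine lt_of_mul_lt_mul_left ?_ s3.le
  have key : Real.sinh h * ((1 - T) * timeCoord (c t) - p * ⟪spaceCoord (c t), u⟫)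
      = Real.sinh (h - t) * ((1 - T) * timeCoord (c 0) - p * ⟪spaceCoord (c 0), u⟫)
        + Real.sinh t * ((1 - T) * timeCoord (c h) - p * ⟪spaceCoord (c h), u⟫) := by
    linear_combination (1 - T) * g1 - p * g3
  rw [key]
  have hle : Real.sinh (h - t) * T + Real.sinh t * T ≤ Real.sinh h * T := by nlinarith
  refine lt_of_lt_of_le ?_ hle
  rcases eq_or_lt_of_le s1 with h0 | h0
  · have : 0 < Real.sinh (h - t) := by rw [sadd, ← h0] at s3; nlinarith
    have := mul_lt_mul_of_pos_left hx this
    rw [← h0]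
    linarith
  · have := mul_lt_mul_of_pos_left hy h0
    have := mul_le_mul_of_nonneg_left hx.le s2
    linarith

theorem connectedComponentIn_eq_convexSide {lam s : ℝ} {u x : E d} (hx : x ∈ convexSide lam s u) :
    connectedComponentIn (unitBall d \ hyperplaneSet lam s u) x = convexSide lam s u := by
  have hsub : convexSide lam s u ⊆ unitBall d \ hyperplaneSet lam s u := by
    rintro y ⟨hy1, hy2⟩
    refine ⟨hy2, fun hy => ?_⟩
    have h1 := hy.1
    rw [mem_sphere] at h1
    rw [mem_ball] at hy1
    linarith
  apply Subset.antisymm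
  · refine subset_inter ?_ ((connectedComponentIn_subset _ _).trans sdiff_subset)
    · refine isPreconnected_connectedComponentIn.subset_left_of_subset_union isOpen_ball
        (isClosed_closedBall (x := (eucRadius s + sphereRadius lam s) • u)
          (ε := sphereRadius lam s)).isOpen_compl ?_ ?_ ⟨x, mem_connectedComponentIn (hsub hx), hx.1⟩
      · exact disjoint_compl_right.mono_right (compl_subset_compl.2 ball_subset_closedBall)
      · intro y hy
        have h1 := connectedComponentIn_subset _ _ hy
        rcases lt_trichotomy (dist y ((eucRadius s + sphereRadius lam s) • u))
          (sphereRadius lam s) with h | h | h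
        · exact Or.inl h
        · exact absurd ⟨h, h1.1⟩ h1.2
        · exact Or.inr (by simpa using h)
  · exact ((convex_ball _ _).inter (convex_ball _ _)).isPreconnected.subset_connectedComponentIn
      hx hsub

theorem originOnNonconvexSide_hyperplaneSet {lam s : ℝ} (hl : 0 ≤ lam) (hs : 0 < s) {u : E d}
    (hu : ‖u‖ = 1) : OriginOnNonconvexSide (hyperplaneSet lam s u) := by
  have h0 := eucRadius_pos hs
  have h1 := eucRadius_lt_one s
  have hR := sphereRadius_pos hl hs
  have hdist : dist (0 : E d) ((eucRadius s + sphereRadius lam s) • u)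
      = eucRadius s + sphereRadius lam s := by
    rw [dist_eq_norm, zero_sub, norm_neg, norm_smul, hu, mul_one, Real.norm_eq_abs,
      abs_of_pos (by positivity)]
  -- a point slightly beyond the nearest point
  obtain ⟨q, hq1, hq2⟩ : ∃ q, eucRadius s < q ∧ q < min 1 (eucRadius s + sphereRadius lam s) :=
    exists_between (lt_min h1 (by linarith))
  have hq3 := lt_of_lt_of_le hq2 (min_le_left _ _)
  have hq4 := lt_of_lt_of_le hq2 (min_le_right _ _)
  have hmem : q • u ∈ convexSide lam s u := by
    constructor
    · rw [mem_ball, dist_eq_norm, ← sub_smul, norm_smul, hu, mul_one, Real.norm_eq_abs, abs_lt]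
      constructor <;> linarith
    · rw [mem_ball_zero_iff, norm_smul, hu, mul_one, Real.norm_eq_abs, abs_lt]
      constructor <;> linarith
  refine ⟨fun h => ?_, q • u, ⟨hmem.2, fun h => ?_⟩, ?_⟩
  · have := h.1
    rw [mem_sphere, hdist] at this
    linarith
  · have h2 := hmem.1
    have h3 := h.1
    rw [mem_sphere] at h3
    rw [mem_ball] at h2
    linarith
  · rw [connectedComponentIn_eq_convexSide hmem]
    refine ⟨isHypConvex_convexSide hl hs hu, fun h => ?_⟩
    have := h.1
    rw [mem_ball, hdist] at this
    linarith

end Aux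

/-- The parametrisation `(s, u) ↦ H_h(s, u)` of `HypO d lam` by the hyperbolic distance `s > 0`
from `o` and the direction `u ∈ 𝕊^{d-1}`. -/
noncomputable def hyperplane {d : ℕ} (hd : 2 ≤ d) {lam : ℝ} (hl : lam ∈ Icc (0 : ℝ) 1)
    (p : Ioi (0 : ℝ) × sphere (0 : E d) 1) : HypO d lam :=
  ⟨hyperplaneSet lam p.1 (p.2 : E d),
    isLambdaGeodesic_hyperplaneSet hd hl p.1.2 (mem_sphere_zero_iff_norm.1 p.2.2),
    originOnNonconvexSide_hyperplaneSet hl.1 p.1.2 (mem_sphere_zero_iff_norm.1 p.2.2)⟩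

/-- The normalised surface measure `σ_{d-1}` on the unit sphere. -/
noncomputable def sphereMeasure (d : ℕ) : Measure (sphere (0 : E d) 1) :=
  ((volume : Measure (E d)).toSphere univ)⁻¹ • (volume : Measure (E d)).toSphere

/-- The measure `ν_λ^o(·) = ∫_0^∞ ∫_{𝕊^{d-1}} 1{H_h(s, u) ∈ ·} (cosh s + λ sinh s)^{d-1} σ(du) ds`,
the restriction of the invariant measure to the hyperplanes with `o` on the non-convex side. -/
noncomputable def nuO {d : ℕ} (hd : 2 ≤ d) {lam : ℝ} (hl : lam ∈ Icc (0 : ℝ) 1) :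
    Measure (HypO d lam) :=
  (((Measure.comap Subtype.val (volume : Measure ℝ) : Measure (Ioi (0 : ℝ))).prod (sphereMeasure d)).withDensity
    fun p => ENNReal.ofReal ((Real.cosh p.1 + lam * Real.sinh p.1) ^ (d - 1))).map
      (hyperplane hd hl)

/-- The intensity measure `μ_{γ,λ} = γ ν_λ^o`. -/
noncomputable def mu {d : ℕ} (hd : 2 ≤ d) {lam : ℝ} (hl : lam ∈ Icc (0 : ℝ) 1) (γ : ℝ) :
    Measure (HypO d lam) :=
  ENNReal.ofReal γ • nuO hd hl

/-- The parametrisation is measurable, so that `nuO` is a genuine image measure. -/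
theorem measurable_hyperplane {d : ℕ} (hd : 2 ≤ d) {lam : ℝ} (hl : lam ∈ Icc (0 : ℝ) 1) :
    Measurable (hyperplane hd hl) := by
  refine measurable_generateFrom ?_
  rintro _ ⟨C, hC, hCb, rfl⟩
  have hr : Continuous fun s : ℝ => eucRadius s := by
    unfold eucRadius
    simp only [Real.tanh_eq_sinh_div_cosh]
    exact (Real.continuous_sinh.comp (continuous_id.div_const 2)).div
      (Real.continuous_cosh.comp (continuous_id.div_const 2)) fun s => (Real.cosh_pos _).ne'
  have hr' : Continuous fun p : Ioi (0 : ℝ) × sphere (0 : E d) 1 => eucRadius p.1 := by fun_prop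
  have hR : Continuous fun p : Ioi (0 : ℝ) × sphere (0 : E d) 1 => sphereRadius lam p.1 := by
    unfold sphereRadius
    refine Continuous.div (by fun_prop) (by fun_prop) fun p => ?_
    have h1 := eucRadius_pos p.1.2
    have h2 := hl.1
    positivity
  have : CompactSpace C := isCompact_iff_compactSpace.1 hC
  have hcl : IsClosed {q : (Ioi (0 : ℝ) × sphere (0 : E d) 1) × C |
      dist (q.2 : E d) ((eucRadius q.1.1 + sphereRadius lam q.1.1) • (q.1.2 : E d))
        = sphereRadius lam q.1.1} := by
    have a1 := hr'.comp (continuous_fst (X := Ioi (0 : ℝ) × sphere (0 : E d) 1) (Y := C))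
    have a2 := hR.comp (continuous_fst (X := Ioi (0 : ℝ) × sphere (0 : E d) 1) (Y := C))
    refine isClosed_eq (Continuous.dist (by fun_prop) ?_) a2
    exact (a1.add a2).smul (by fun_prop)
  have heq : hyperplane hd hl ⁻¹' hitting lam C = Prod.fst '' {q : (Ioi (0 : ℝ) ×
      sphere (0 : E d) 1) × C |
      dist (q.2 : E d) ((eucRadius q.1.1 + sphereRadius lam q.1.1) • (q.1.2 : E d))
        = sphereRadius lam q.1.1} := by
    ext p
    constructor
    · rintro ⟨x, ⟨hx1, -⟩, hx2⟩
      exact ⟨(p, ⟨x, hx2⟩), hx1, rfl⟩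
    · rintro ⟨⟨p', x⟩, hx, rfl⟩
      exact ⟨x, ⟨hx, hCb x.2⟩, x.2⟩
  rw [heq]
  exact (isClosedMap_fst_of_compactSpace _ hcl).measurableSet

end LambdaGeod

namespace LambdaGeod

variable {d : ℕ}

/-! In the hyperboloid model the hyperplane with parameters `s`, `u` is the affine section `A X₀ - B
⟪X, u⟫ = λ`, where `B = cosh s + λ sinh s` and `A = sinh s + λ cosh s` (`mem_hyperplaneSet_iff`).
Two facts make everything explicit: `A = dB/ds`, and `B² - A² = 1 - λ²`. Encode the hyperplane by
the Euclidean vector `x = B u`, which ranges over `‖x‖ > 1`. Then `A = √(‖x‖² - 1 + λ²)`, and polar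
coordinates turn the weight `B^(d-1) ds du`, with `du` the unnormalised surface measure, into `dx /
A`, the Lorentz-invariant measure on the pseudosphere (`lintegral_weight_hitRegion`).

A geodesic from `o` is `t ↦ (cosh t, sinh t • v)` (`exists_direction`), so it is hit when `A cosh t
- ⟪x, v⟫ sinh t = λ` for some `t ∈ [0, h]`. Fix the component `w` of `x` orthogonal to `v` and let
`a = ⟪x, v⟫` vary. If `‖w‖ > 1` there is no solution. If `‖w‖ < 1`, the solutions are `a = λ sinh t
+ q cosh t` with `q = √(1 - ‖w‖²)` and `0 < t ≤ h` (`hitSlice_eq_image`). Along this curve `da/dt =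
A`, so `da / A = dt` and every such line contributes exactly `h`, whatever `λ` and `w` are
(`lintegral_hitSlice`).

The total is therefore `h` times the volume of the unit ball in dimension `d - 1`. Division by the
area of the unit sphere in dimension `d` gives the constant (`volume_ball_div_toSphere_univ`). -/

/-! ### Hyperplanes and geodesics in hyperboloid coordinates -/

theorem sinh_eq_eucRadius (s : ℝ) : Real.sinh s * (1 - eucRadius s ^ 2) = 2 * eucRadius s := by
  have h1 : Real.sinh s = 2 * Real.sinh (s / 2) * Real.cosh (s / 2) := by
    rw [← Real.sinh_two_mul]; congr 1; ring
  have h2 := Real.cosh_sq (s / 2)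
  have h3 := (Real.cosh_pos (s / 2)).ne'
  rw [h1, eucRadius, Real.tanh_eq_sinh_div_cosh]
  field_simp
  rw [h2]
  ring

theorem cosh_eq_eucRadius (s : ℝ) :
    Real.cosh s * (1 - eucRadius s ^ 2) = 1 + eucRadius s ^ 2 := by
  have h1 : Real.cosh s = Real.cosh (s / 2) ^ 2 + Real.sinh (s / 2) ^ 2 := by
    rw [← Real.cosh_two_mul]; congr 1; ring
  have h2 := Real.cosh_sq (s / 2)
  have h3 := (Real.cosh_pos (s / 2)).ne'
  rw [h1, eucRadius, Real.tanh_eq_sinh_div_cosh]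
  field_simp
  rw [h2]
  ring

/-- This identity and the next rescale the Euclidean equation of the sphere: its coefficients `1 -
Rλ` and `r + R`, divided by `R`, become the hyperbolic coefficients `A` and `B`. -/
theorem sphereRadius_mul_sinh {lam s : ℝ} (hl : 0 ≤ lam) (hs : 0 < s) :
    sphereRadius lam s * (Real.sinh s + lam * Real.cosh s) = 1 - sphereRadius lam s * lam := by
  have h0 := eucRadius_pos hs
  have : lam + eucRadius s ≠ 0 := by positivity
  unfold sphereRadius
  field_simp
  linear_combination sinh_eq_eucRadius s + lam * cosh_eq_eucRadius s

theorem sphereRadius_mul_cosh {lam s : ℝ} (hl : 0 ≤ lam) (hs : 0 < s) :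
    sphereRadius lam s * (Real.cosh s + lam * Real.sinh s) = eucRadius s + sphereRadius lam s := by
  have h0 := eucRadius_pos hs
  have : lam + eucRadius s ≠ 0 := by positivity
  unfold sphereRadius
  field_simp
  linear_combination lam * sinh_eq_eucRadius s + cosh_eq_eucRadius s

/-- The equation of a `λ`-geodesic hyperplane in the hyperboloid model. -/
theorem mem_hyperplaneSet_iff {lam s : ℝ} (hl : 0 ≤ lam) (hs : 0 < s) {u : E d} (hu : ‖u‖ = 1)
    {x : E d} (hx : x ∈ unitBall d) :
    x ∈ hyperplaneSet lam s u ↔ (Real.sinh s + lam * Real.cosh s) * timeCoord x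
        - (Real.cosh s + lam * Real.sinh s) * ⟪spaceCoord x, u⟫ = lam := by
  have hR := sphereRadius_pos hl hs
  have he := sphereRadius_eq hl hs
  have hx' := hx
  rw [mem_ball_zero_iff] at hx'
  have h1 : 0 < 1 - ‖x‖ ^ 2 := by nlinarith [norm_nonneg x]
  have e1 := sphereRadius_mul_sinh hl hs
  have e2 := sphereRadius_mul_cosh hl hs
  rw [hyperplaneSet, mem_inter_iff, and_iff_left hx, mem_sphere, dist_eq_norm,
    ← sq_eq_sq₀ (norm_nonneg _) hR.le, norm_sub_smul_sq x u hu, timeCoord, spaceCoord,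
    inner_smul_left]
  simp only [RCLike.conj_to_real]
  -- Multiplying by `R` and by `1 - ‖x‖²` makes both sides polynomial in `‖x‖²` and `⟪x, u⟫`; they
  -- then agree by the law of cosines `he`.
  rw [← mul_right_inj' hR.ne' (b := _ - _), ← mul_left_inj' h1.ne' (a := _ * (_ - _))]
  have : sphereRadius lam s * ((Real.sinh s + lam * Real.cosh s) *
        ((1 + ‖x‖ ^ 2) / (1 - ‖x‖ ^ 2)) -
      (Real.cosh s + lam * Real.sinh s) * (2 / (1 - ‖x‖ ^ 2) * ⟪x, u⟫)) * (1 - ‖x‖ ^ 2)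
      = (1 - sphereRadius lam s * lam) * (1 + ‖x‖ ^ 2) -
      (eucRadius s + sphereRadius lam s) * 2 * ⟪x, u⟫ := by
    rw [← e1, ← e2]
    field_simp
  rw [this]
  constructor <;> intro h <;> linarith

/-- A geodesic from the origin in the hyperboloid model. -/
theorem exists_direction {h : ℝ} (hd : 2 ≤ d) (hh : 0 ≤ h) {c : ℝ → E d}
    (hc : ∀ t ∈ Icc 0 h, c t ∈ unitBall d)
    (hdist : ∀ s ∈ Icc 0 h, ∀ t ∈ Icc 0 h, poincareDist (c s) (c t) = |s - t|)
    (h0 : c 0 = 0) :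
    ∃ v : E d, ‖v‖ = 1 ∧ ∀ t ∈ Icc 0 h, timeCoord (c t) = Real.cosh t ∧
      spaceCoord (c t) = Real.sinh t • v := by
  have m0 : (0 : ℝ) ∈ Icc 0 h := ⟨le_rfl, hh⟩
  have mh : h ∈ Icc 0 h := ⟨hh, le_rfl⟩
  have z1 : timeCoord (0 : E d) = 1 := by simp [timeCoord]
  have z2 : spaceCoord (0 : E d) = 0 := by simp [spaceCoord]
  have ht : ∀ t ∈ Icc 0 h, timeCoord (c t) = Real.cosh t := by
    intro t ht
    have := cosh_poincareDist' (hc 0 m0) (hc t ht)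
    rw [hdist 0 m0 t ht, h0, z1, z2, inner_zero_left, zero_sub, abs_neg, Real.cosh_abs] at this
    linarith
  -- A degenerate segment has no direction, and any unit vector serves; otherwise the endpoint
  -- determines `v`.
  rcases eq_or_lt_of_le hh with rfl | hpos
  · have : Nontrivial (E d) := Module.nontrivial_of_finrank_pos (R := ℝ)
      (by rw [finrank_euclideanSpace_fin]; omega)
    obtain ⟨v, hv⟩ := exists_norm_eq (E d) zero_le_one
    refine ⟨v, hv, fun t htt => ⟨ht t htt, ?_⟩⟩
    obtain rfl : t = 0 := le_antisymm htt.2 htt.1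
    rw [h0, z2, Real.sinh_zero, zero_smul]
  · have s3 : 0 < Real.sinh h := Real.sinh_pos_iff.2 hpos
    refine ⟨(Real.sinh h)⁻¹ • spaceCoord (c h), ?_, fun t htt => ⟨ht t htt, ?_⟩⟩
    · have := timeCoord_sq (hc h mh)
      rw [ht h mh, Real.cosh_sq, real_inner_self_eq_norm_sq, add_comm, add_right_inj,
        sq_eq_sq₀ s3.le (norm_nonneg _)] at this
      rw [norm_smul, ← this, norm_inv, Real.norm_of_nonneg s3.le, inv_mul_cancel₀ s3.ne']
    · have d1 := hdist 0 m0 t htt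
      have d2 := hdist t htt h mh
      have d3 := hdist 0 m0 h mh
      rw [zero_sub, abs_neg, abs_of_nonneg htt.1] at d1
      rw [abs_sub_comm, abs_of_nonneg (sub_nonneg.2 htt.2)] at d2
      rw [zero_sub, abs_neg, abs_of_nonneg hh] at d3
      obtain ⟨-, g2⟩ := hyperboloid_combination (hc 0 m0) (hc h mh) (hc t htt) d1 d2
        (by rw [d3]; ring)
      rw [h0, z2, smul_zero, zero_add, add_sub_cancel] at g2
      rw [smul_comm, ← g2, inv_smul_smul₀ s3.ne']

/-! ### The hitting condition on the pseudosphere -/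

/-- The squared last coordinate on the pseudosphere that parametrises `HypO`. -/
noncomputable def pseudoTime (lam : ℝ) (x : E d) : ℝ := √(‖x‖ ^ 2 - 1 + lam ^ 2)

/-- The points of the pseudosphere, projected to Euclidean space, whose `λ`-geodesic hyperplanes
hit the segment of length `h` from the origin in direction `v`. -/
def hitRegion (lam h : ℝ) (v : E d) : Set (E d) :=
  {x | 1 < ‖x‖ ∧ ∃ t ∈ Icc 0 h, pseudoTime lam x * Real.cosh t - ⟪x, v⟫ * Real.sinh t = lam}

theorem one_lt_cosh_add {lam s : ℝ} (hl : 0 ≤ lam) (hs : 0 < s) :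
    1 < Real.cosh s + lam * Real.sinh s := by
  have h1 := Real.one_lt_cosh.2 hs.ne'
  have h2 := Real.sinh_pos_iff.2 hs
  nlinarith

/-- The relation `B² - A² = 1 - λ²` together with `A ≥ 0`: the vector `B u` alone recovers `A`. -/
theorem sqrt_cosh_add {lam s : ℝ} (hl : 0 ≤ lam) (hs : 0 ≤ s) :
    √((Real.cosh s + lam * Real.sinh s) ^ 2 - 1 + lam ^ 2) = Real.sinh s + lam * Real.cosh s := by
  have h1 := Real.cosh_sq s
  have h2 := Real.sinh_nonneg_iff.2 hs
  have h3 := Real.cosh_pos s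
  rw [Real.sqrt_eq_iff_eq_sq (by nlinarith [sq_nonneg lam, mul_nonneg hl h2]) (by positivity)]
  linear_combination (1 - lam ^ 2) * h1

theorem mem_hitRegion_iff {lam s h : ℝ} (hl : 0 ≤ lam) (hs : 0 < s) {u v : E d} (hu : ‖u‖ = 1) :
    (Real.cosh s + lam * Real.sinh s) • u ∈ hitRegion lam h v ↔
      ∃ t ∈ Icc 0 h, (Real.sinh s + lam * Real.cosh s) * Real.cosh t
        - (Real.cosh s + lam * Real.sinh s) * (Real.sinh t * ⟪v, u⟫) = lam := by
  have hB := one_lt_cosh_add hl hs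
  have hn : ‖(Real.cosh s + lam * Real.sinh s) • u‖ = Real.cosh s + lam * Real.sinh s := by
    rw [norm_smul, hu, mul_one, Real.norm_of_nonneg (by linarith)]
  rw [hitRegion, mem_ofPred_eq, pseudoTime, hn, sqrt_cosh_add hl hs.le, and_iff_right hB,
    inner_smul_left, real_inner_comm u v]
  simp only [RCLike.conj_to_real]
  refine exists_congr fun t => and_congr_right fun _ => ?_
  rw [mul_right_comm, mul_assoc]

/-- The existential over `t` is a projection along the compact factor `[0, h]`, which is a closed
map. -/
theorem measurableSet_hitRegion (lam h : ℝ) (v : E d) : MeasurableSet (hitRegion lam h v) := by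
  have hcl : IsClosed {q : E d × Icc (0 : ℝ) h |
      pseudoTime lam q.1 * Real.cosh q.2 - ⟪q.1, v⟫ * Real.sinh q.2 = lam} := by
    unfold pseudoTime
    refine isClosed_eq ?_ continuous_const
    have := Real.continuous_cosh
    have := Real.continuous_sinh
    fun_prop
  have heq : hitRegion lam h v = {x | 1 < ‖x‖} ∩ Prod.fst '' {q : E d × Icc (0 : ℝ) h |
      pseudoTime lam q.1 * Real.cosh q.2 - ⟪q.1, v⟫ * Real.sinh q.2 = lam} := by
    ext x
    refine and_congr_right fun _ => ⟨?_, ?_⟩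
    · rintro ⟨t, ht, hx⟩
      exact ⟨(x, ⟨t, ht⟩), hx, rfl⟩
    · rintro ⟨⟨x', t⟩, hx, rfl⟩
      exact ⟨t, t.2, hx⟩
  rw [heq]
  exact (isOpen_lt continuous_const continuous_norm).measurableSet.inter
    (isClosedMap_fst_of_compactSpace _ hcl).measurableSet

theorem hyperplane_mem_hitting_iff {lam h : ℝ} (hd : 2 ≤ d) (hl : lam ∈ Icc (0 : ℝ) 1) {c : ℝ → E d}
    (hc : ∀ t ∈ Icc 0 h, c t ∈ unitBall d) {v : E d}
    (hv : ∀ t ∈ Icc 0 h, timeCoord (c t) = Real.cosh t ∧ spaceCoord (c t) = Real.sinh t • v)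
    (p : Ioi (0 : ℝ) × sphere (0 : E d) 1) :
    hyperplane hd hl p ∈ hitting lam (c '' Icc 0 h) ↔
      (Real.cosh p.1 + lam * Real.sinh p.1) • (p.2 : E d) ∈ hitRegion lam h v := by
  have hu : ‖(p.2 : E d)‖ = 1 := mem_sphere_zero_iff_norm.1 p.2.2
  have key : ∀ t ∈ Icc 0 h, c t ∈ hyperplaneSet lam p.1 (p.2 : E d) ↔
      (Real.sinh p.1 + lam * Real.cosh p.1) * Real.cosh t
        - (Real.cosh p.1 + lam * Real.sinh p.1) * (Real.sinh t * ⟪v, (p.2 : E d)⟫) = lam := by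
    intro t ht
    rw [mem_hyperplaneSet_iff hl.1 p.1.2 hu (hc t ht), (hv t ht).1, (hv t ht).2, inner_smul_left,
      RCLike.conj_to_real]
  rw [mem_hitRegion_iff hl.1 p.1.2 hu]
  constructor
  · rintro ⟨_, hx, t, ht, rfl⟩
    exact ⟨t, ht, (key t ht).1 hx⟩
  · rintro ⟨t, ht, hx⟩
    exact ⟨c t, (key t ht).2 hx, t, ht, rfl⟩

/-- The σ-algebra is generated by hitting sets of compact sets, so compactness makes the event
measurable. Continuity is read off the inverse of the model change, `x = spaceCoord x / (1 +
timeCoord x)`. -/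
theorem isCompact_geodesic {h : ℝ} {c : ℝ → E d} {v : E d} (hc : ∀ t ∈ Icc 0 h, c t ∈ unitBall d)
    (hv : ∀ t ∈ Icc 0 h, timeCoord (c t) = Real.cosh t ∧ spaceCoord (c t) = Real.sinh t • v) :
    IsCompact (c '' Icc 0 h) := by
  refine isCompact_Icc.image_of_continuousOn ?_
  have heq : EqOn c (fun t => (1 + Real.cosh t)⁻¹ • Real.sinh t • v) (Icc 0 h) := by
    intro t ht
    have h1 := hc t ht
    rw [mem_ball_zero_iff] at h1
    have h2 : 1 - ‖c t‖ ^ 2 ≠ 0 := by nlinarith [norm_nonneg (c t)]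
    change c t = (1 + Real.cosh t)⁻¹ • Real.sinh t • v
    rw [← (hv t ht).2, ← (hv t ht).1, timeCoord, spaceCoord, smul_smul]
    have : (1 + (1 + ‖c t‖ ^ 2) / (1 - ‖c t‖ ^ 2))⁻¹ * (2 / (1 - ‖c t‖ ^ 2)) = 1 := by
      rw [show 1 + (1 + ‖c t‖ ^ 2) / (1 - ‖c t‖ ^ 2) = 2 / (1 - ‖c t‖ ^ 2) by field_simp; ring]
      exact inv_mul_cancel₀ (by positivity)
    rw [this, one_smul]
  have hcont : Continuous fun t : ℝ => (1 + Real.cosh t)⁻¹ • Real.sinh t • v := by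
    have hden : Continuous fun t : ℝ => 1 + Real.cosh t :=
      continuous_const.add Real.continuous_cosh
    have hne : ∀ t : ℝ, 1 + Real.cosh t ≠ 0 := fun t => by
      have := Real.cosh_pos t
      positivity
    exact (hden.inv₀ hne).smul (Real.continuous_sinh.smul continuous_const)
  exact hcont.continuousOn.congr heq


/-! ### From the parameter measure to Lebesgue measure -/

theorem lintegral_sphere_polar (hd : 1 ≤ d) {f : E d → ℝ≥0∞} (hf : Measurable f) :
    ∫⁻ x, f x = ∫⁻ u : sphere (0 : E d) 1, (∫⁻ r in Ioi (0 : ℝ),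
      ENNReal.ofReal (r ^ (d - 1)) * f (r • (u : E d))) ∂(volume : Measure (E d)).toSphere := by
  have : Nontrivial (E d) := Module.nontrivial_of_finrank_pos (R := ℝ)
      (by rw [finrank_euclideanSpace_fin]; omega)
  have hmp := (volume : Measure (E d)).measurePreserving_homeomorphUnitSphereProd
  have hg : Measurable fun p : sphere (0 : E d) 1 × Ioi (0 : ℝ) => f ((p.2 : ℝ) • (p.1 : E d)) := by
    fun_prop
  have h1 := hmp.lintegral_comp hg
  have h2 : ∀ x : ({0}ᶜ : Set (E d)), ((homeomorphUnitSphereProd (E d) x).2 : ℝ) •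
      ((homeomorphUnitSphereProd (E d) x).1 : E d) = x := fun x => by
    rw [← homeomorphUnitSphereProd_symm_apply_coe, Homeomorph.symm_apply_apply]
  simp only [h2] at h1
  rw [lintegral_subtype_comap (measurableSet_singleton _).compl, restrict_compl_singleton,
    lintegral_prod _ hg.aemeasurable, finrank_euclideanSpace_fin] at h1
  rw [h1]
  refine lintegral_congr fun u => ?_
  rw [Measure.volumeIoiPow, lintegral_withDensity_eq_lintegral_mul _ (by fun_prop) (by fun_prop)]
  exact lintegral_subtype_comap measurableSet_Ioi
    fun r => ENNReal.ofReal (r ^ (d - 1)) * f (r • (u : E d))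

/-- Polar coordinates followed by the radial substitution `r = B s`, a bijection from `(0, ∞)` onto
`(1, ∞)` with `dr = A ds`; the Jacobian `A` cancels the density `1 / A`. -/
theorem lintegral_weight_hitRegion (hd : 1 ≤ d) {lam : ℝ} (hl : 0 ≤ lam) (h : ℝ) (v : E d) :
    ∫⁻ p in {p : Ioi (0 : ℝ) × sphere (0 : E d) 1 |
        (Real.cosh p.1 + lam * Real.sinh p.1) • (p.2 : E d) ∈ hitRegion lam h v},
      ENNReal.ofReal ((Real.cosh p.1 + lam * Real.sinh p.1) ^ (d - 1))
      ∂((Measure.comap Subtype.val (volume : Measure ℝ) : Measure (Ioi (0 : ℝ))).prod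
        (volume : Measure (E d)).toSphere)
    = ∫⁻ x in hitRegion lam h v, ENNReal.ofReal (pseudoTime lam x)⁻¹ := by
  have hc := Real.measurable_cosh
  have hs := Real.measurable_sinh
  have hm := measurableSet_hitRegion lam h v
  have hpt : Measurable (pseudoTime (d := d) lam) := by unfold pseudoTime; fun_prop
  set B : ℝ → ℝ := fun s => Real.cosh s + lam * Real.sinh s with hB
  set A : ℝ → ℝ := fun s => Real.sinh s + lam * Real.cosh s with hA
  have hderiv : ∀ s, HasDerivAt B (A s) s := fun s =>
    (Real.hasDerivAt_cosh s).add ((Real.hasDerivAt_sinh s).const_mul lam)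
  have hApos : ∀ s ∈ Ioi (0 : ℝ), 0 < A s := fun s hs => by
    have := Real.sinh_pos_iff.2 hs
    have := Real.cosh_pos s
    positivity
  have hmono : StrictMonoOn B (Ici 0) := by
    refine strictMonoOn_of_deriv_pos (convex_Ici 0)
      (fun s _ => (hderiv s).continuousAt.continuousWithinAt) fun s hs => ?_
    rw [interior_Ici] at hs
    rw [(hderiv s).deriv]
    exact hApos s hs
  have himage : B '' Ioi 0 = Ioi 1 := by
    ext r
    constructor
    · rintro ⟨s, hs, rfl⟩
      exact one_lt_cosh_add hl hs
    · intro hr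
      have hr' : (1 : ℝ) < r := hr
      have hT : (0 : ℝ) ≤ r := by linarith
      have h0 : B 0 = 1 := by simp [hB]
      -- Since `r ≤ sinh r < cosh r ≤ B r`, the interval `[0, r]` already suffices for the
      -- intermediate value theorem.
      have hr2 : r ≤ B r := by
        have := Real.self_le_sinh_iff.2 hT
        have h2 := Real.sinh_lt_cosh r
        have h3 := mul_nonneg hl (Real.sinh_nonneg_iff.2 hT)
        simp only [hB]
        linarith
      obtain ⟨s, hs, hsr⟩ := intermediate_value_Icc hT
        (fun s _ => (hderiv s).continuousAt.continuousWithinAt) (show r ∈ Icc (B 0) (B r) from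
          ⟨by rw [h0]; exact hr'.le, hr2⟩)
      refine ⟨s, lt_of_le_of_ne hs.1 ?_, hsr⟩
      rintro rfl
      rw [h0] at hsr
      exact hr'.ne hsr
  have hF : Measurable ((hitRegion lam h v).indicator
      fun x => ENNReal.ofReal (pseudoTime lam x)⁻¹) :=
    Measurable.indicator (by fun_prop) hm
  have hpre : MeasurableSet {p : Ioi (0 : ℝ) × sphere (0 : E d) 1 |
        B p.1 • (p.2 : E d) ∈ hitRegion lam h v} :=
    hm.preimage (f := fun p : Ioi (0 : ℝ) × sphere (0 : E d) 1 => B p.1 • (p.2 : E d))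
      (by fun_prop)
  -- The density of `volumeIoiPow 0` is `r ^ 0 = 1`, so its s-finiteness transfers.
  have hsf : SFinite (Measure.comap Subtype.val (volume : Measure ℝ) : Measure (Ioi (0 : ℝ))) := by
    rw [show Measure.comap Subtype.val volume = Measure.volumeIoiPow 0 by
      simp [Measure.volumeIoiPow]]
    infer_instance
  rw [← lintegral_indicator hm, lintegral_sphere_polar hd hF, ← lintegral_indicator hpre,
    lintegral_prod_symm _ (Measurable.indicator (by fun_prop) hpre).aemeasurable]
  refine lintegral_congr fun u => ?_
  have hu : ‖(u : E d)‖ = 1 := mem_sphere_zero_iff_norm.1 u.2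
  set G : ℝ → ℝ≥0∞ := fun r => ENNReal.ofReal (r ^ (d - 1)) *
    (hitRegion lam h v).indicator (fun x => ENNReal.ofReal (pseudoTime lam x)⁻¹) (r • (u : E d))
    with hG
  -- Radii `r ≤ 1` contribute nothing, because the hit region lies in `‖x‖ > 1`.
  have hres : ∫⁻ r in Ioi 0, G r = ∫⁻ r in B '' Ioi 0, G r := by
    rw [himage]
    rw [← lintegral_indicator measurableSet_Ioi, ← lintegral_indicator measurableSet_Ioi]
    refine lintegral_congr fun r => ?_
    by_cases hr1 : r ∈ Ioi (1 : ℝ)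
    · rw [indicator_of_mem hr1, indicator_of_mem (Ioi_subset_Ioi zero_le_one hr1)]
    rw [indicator_of_notMem hr1, indicator_apply_eq_zero]
    intro hr
    rw [hG]
    simp only
    rw [indicator_of_notMem, mul_zero]
    rintro ⟨hn, -⟩
    rw [norm_smul, hu, mul_one, Real.norm_of_nonneg (le_of_lt hr)] at hn
    exact hr1 hn
  rw [hres, lintegral_image_eq_lintegral_abs_deriv_mul measurableSet_Ioi
    (fun s _ => (hderiv s).hasDerivWithinAt) (hmono.mono Ioi_subset_Ici_self).injOn]
  refine Eq.trans (lintegral_subtype_comap measurableSet_Ioi fun s : ℝ =>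
    {s : ℝ | B s • (u : E d) ∈ hitRegion lam h v}.indicator
      (fun s => ENNReal.ofReal (B s ^ (d - 1))) s) ?_
  refine setLIntegral_congr_fun measurableSet_Ioi fun s hs => ?_
  simp only [hG]
  by_cases hmem : B s • (u : E d) ∈ hitRegion lam h v
  · have hBs : 0 < B s := lt_trans zero_lt_one (one_lt_cosh_add hl hs)
    rw [indicator_of_mem hmem,
      indicator_of_mem (s := {s : ℝ | B s • (u : E d) ∈ hitRegion lam h v}) hmem,
      abs_of_pos (hApos s hs), pseudoTime, norm_smul, hu,
      mul_one, Real.norm_of_nonneg hBs.le, sqrt_cosh_add hl (le_of_lt hs),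
      ENNReal.ofReal_inv_of_pos (hApos s hs), mul_left_comm, ENNReal.mul_inv_cancel, mul_one]
    · simpa using hApos s hs
    · exact ENNReal.ofReal_ne_top
  · rw [indicator_of_notMem hmem,
      indicator_of_notMem (s := {s : ℝ | B s • (u : E d) ∈ hitRegion lam h v}) hmem, mul_zero, mul_zero]

/-! ### The integral along one line -/

/-- The points of a line parallel to the direction of the segment, at squared distance `k` from the
line through the origin, that lie in the hit region. -/
def hitSlice (lam h k : ℝ) : Set ℝ :=
  {a | 1 < a ^ 2 + k ∧ ∃ t ∈ Icc 0 h,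
    √(a ^ 2 + k - 1 + lam ^ 2) * Real.cosh t - a * Real.sinh t = lam}

/-- The Lorentz boost by `t` preserves `A² - a² = k - 1 + λ²`. If it sends `A` to `λ`, it sends `a`
to a number of square `1 - k`, which cannot be negative. -/
theorem hitSlice_eq_empty {lam h k : ℝ} (hk : 1 < k) : hitSlice lam h k = ∅ := by
  refine eq_empty_of_forall_notMem ?_
  rintro a ⟨h1, t, ht, h2⟩
  have h3 := Real.sq_sqrt (show 0 ≤ a ^ 2 + k - 1 + lam ^ 2 by nlinarith [sq_nonneg lam])
  have h4 := Real.cosh_sq t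
  set A := √(a ^ 2 + k - 1 + lam ^ 2)
  have : (a * Real.cosh t - A * Real.sinh t) ^ 2 = 1 - k := by
    rw [← h2] at h3
    linear_combination (a ^ 2 - A ^ 2) * h4 - h3
  nlinarith [sq_nonneg (a * Real.cosh t - A * Real.sinh t)]

/-- The inverse boost applied to `(λ, q)`: the square root equals the `t`-derivative of the curve
that parametrises the slice. -/
theorem sqrt_slice {lam k t : ℝ} (hl : 0 ≤ lam) (hk : k ≤ 1) (ht : 0 ≤ t) :
    √((lam * Real.sinh t + √(1 - k) * Real.cosh t) ^ 2 + k - 1 + lam ^ 2)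
      = lam * Real.cosh t + √(1 - k) * Real.sinh t := by
  have hq := Real.sq_sqrt (show 0 ≤ 1 - k by linarith)
  have h1 := Real.cosh_sq t
  have h2 := Real.sinh_nonneg_iff.2 ht
  have h3 := Real.cosh_pos t
  set q := √(1 - k)
  have hqn : 0 ≤ q := Real.sqrt_nonneg _
  have : (lam * Real.sinh t + q * Real.cosh t) ^ 2 + k - 1 + lam ^ 2
      = (lam * Real.cosh t + q * Real.sinh t) ^ 2 := by
    linear_combination (q ^ 2 - lam ^ 2) * h1 + hq
  rw [this, Real.sqrt_sq (by positivity)]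

/-- Undoing the boost leaves `(λ, ±q)`. The sign `+` is the crossing into the convex side; the sign
`-` is a later crossing out of it. A hit of the second kind is replaced by the first crossing, at
some `τ ≤ t`. The value `t = 0` is excluded since it would give `A = λ`, that is `a² + k = 1`. -/
theorem hitSlice_eq_image {lam h k : ℝ} (hl : 0 ≤ lam) (hk : k < 1) :
    hitSlice lam h k
      = (fun t => lam * Real.sinh t + √(1 - k) * Real.cosh t) '' Ioc 0 h := by
  have hq := Real.sq_sqrt (show 0 ≤ 1 - k by linarith)
  have hq0 : 0 < √(1 - k) := Real.sqrt_pos.2 (by linarith)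
  ext a
  constructor
  · rintro ⟨h1, t, ht, h2⟩
    have h3 := Real.sq_sqrt (show 0 ≤ a ^ 2 + k - 1 + lam ^ 2 by nlinarith [sq_nonneg lam])
    have h4 := Real.cosh_sq t
    have h5 := Real.sinh_nonneg_iff.2 ht.1
    set A := √(a ^ 2 + k - 1 + lam ^ 2)
    have hA : lam < A := Real.lt_sqrt_of_sq_lt (by linarith)
    set q := √(1 - k)
    have hx : (a * Real.cosh t - A * Real.sinh t) ^ 2 = q ^ 2 := by
      rw [← h2] at h3
      linear_combination (a ^ 2 - A ^ 2) * h4 - h3 - hq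
    -- Only the upper bound is kept; it holds for both signs and suffices to bound `A`.
    have hx' : a * Real.cosh t - A * Real.sinh t ≤ q := le_of_sq_le_sq hx.le hq0.le
    have hAt : A ≤ lam * Real.cosh t + q * Real.sinh t := by
      have : A = lam * Real.cosh t + (a * Real.cosh t - A * Real.sinh t) * Real.sinh t := by
        rw [← h2]; linear_combination (-A) * h4
      nlinarith
    -- The time `τ` is chosen to match `A`; since `a²` is determined by `A` and `a ≥ 0`, it then
    -- matches `a` as well.
    obtain ⟨τ, hτ, hτA⟩ := intermediate_value_Icc ht.1
      (f := fun t => lam * Real.cosh t + q * Real.sinh t)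
      ((continuous_const.mul Real.continuous_cosh).add
        (continuous_const.mul Real.continuous_sinh)).continuousOn
      (show A ∈ Icc _ _ from ⟨by simpa using hA.le, hAt⟩)
    simp only at hτA
    have hτ0 : 0 < τ := by
      refine lt_of_le_of_ne hτ.1 ?_
      rintro rfl
      simp at hτA
      exact hA.ne hτA
    have ha : 0 ≤ a := by
      have hs : 0 < Real.sinh t := Real.sinh_pos_iff.2 (hτ0.trans_le hτ.2)
      have h6 := Real.one_le_cosh t
      have : 0 ≤ a * Real.sinh t := by nlinarith
      exact nonneg_of_mul_nonneg_left this hs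
    refine ⟨τ, ⟨hτ0, hτ.2.trans ht.2⟩, ?_⟩
    have h7 := Real.sinh_nonneg_iff.2 hτ.1
    have h8 := Real.cosh_pos τ
    have h9 := Real.cosh_sq τ
    simp only
    rw [← sq_eq_sq₀ (by positivity) ha]
    rw [← hτA] at h3
    linear_combination (q ^ 2 - lam ^ 2) * h9 + h3 + hq
  · rintro ⟨t, ht, rfl⟩
    have h1 := Real.cosh_sq t
    have h2 := Real.sinh_pos_iff.2 ht.1
    have h3 := Real.one_lt_cosh.2 ht.1.ne'
    refine ⟨?_, t, ⟨ht.1.le, ht.2⟩, ?_⟩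
    · simp only
      set q := √(1 - k)
      have : q < lam * Real.sinh t + q * Real.cosh t := by nlinarith
      nlinarith
    · simp only
      rw [sqrt_slice hl hk.le ht.1.le]
      linear_combination lam * h1

/-- In the parameter `t` the integrand is the reciprocal of the Jacobian, so the integral is the
length of `(0, h]`. Linearity in `h` and independence of `λ` come from here. -/
theorem lintegral_hitSlice {lam h k : ℝ} (hl : 0 ≤ lam) (hk : k < 1) :
    ∫⁻ a in hitSlice lam h k, ENNReal.ofReal (√(a ^ 2 + k - 1 + lam ^ 2))⁻¹
      = ENNReal.ofReal h := by
  have hq0 : 0 < √(1 - k) := Real.sqrt_pos.2 (by linarith)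
  have hderiv : ∀ t, HasDerivAt (fun t => lam * Real.sinh t + √(1 - k) * Real.cosh t)
      (lam * Real.cosh t + √(1 - k) * Real.sinh t) t := fun t =>
    ((Real.hasDerivAt_sinh t).const_mul _).add ((Real.hasDerivAt_cosh t).const_mul _)
  have hpos : ∀ t, 0 < t → 0 < lam * Real.cosh t + √(1 - k) * Real.sinh t := fun t ht => by
    have h1 := Real.cosh_pos t
    have h2 := Real.sinh_pos_iff.2 ht
    positivity
  have hmono : StrictMonoOn (fun t => lam * Real.sinh t + √(1 - k) * Real.cosh t) (Ici 0) := by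
    refine strictMonoOn_of_deriv_pos (convex_Ici 0)
      (fun s _ => (hderiv s).continuousAt.continuousWithinAt) fun s hs => ?_
    rw [interior_Ici] at hs
    rw [(hderiv s).deriv]
    exact hpos s hs
  rw [hitSlice_eq_image hl hk, lintegral_image_eq_lintegral_abs_deriv_mul measurableSet_Ioc
    (fun s _ => (hderiv s).hasDerivWithinAt)
    (hmono.mono (Ioc_subset_Ioi_self.trans Ioi_subset_Ici_self)).injOn]
  rw [setLIntegral_congr_fun (g := fun _ => 1) measurableSet_Ioc, setLIntegral_one,
    Real.volume_Ioc, sub_zero]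
  intro t ht
  simp only
  rw [sqrt_slice hl hk.le ht.1.le, abs_of_pos (hpos t ht.1),
    ENNReal.ofReal_inv_of_pos (hpos t ht.1), ENNReal.mul_inv_cancel]
  · simpa using hpos t ht.1
  · exact ENNReal.ofReal_ne_top

/-! ### Integration over all lines parallel to the segment -/

/-- Orthogonal coordinates adapted to a unit vector preserve volume. -/
theorem exists_adapted_coordinates {n : ℕ} {v : E (n + 1)} (hv : ‖v‖ = 1) :
    ∃ e : ℝ × E n → E (n + 1), MeasurePreserving e volume volume ∧
      ∀ p, ‖e p‖ ^ 2 = p.1 ^ 2 + ‖p.2‖ ^ 2 ∧ ⟪e p, v⟫ = p.1 := by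
  obtain ⟨b, hb⟩ := Orthonormal.exists_orthonormalBasis_extension_of_card_eq (𝕜 := ℝ)
    (E := E (n + 1)) (ι := Fin (n + 1)) (by simp) (v := fun _ => v) (s := {0})
    (by
      rw [orthonormal_iff_ite]
      intro i j
      have : i = j := Subsingleton.elim _ _
      simp [this, hv])
  have hb0 : b 0 = v := hb 0 rfl
  have m1 : MeasurePreserving (Prod.map id (WithLp.ofLp : E n → Fin n → ℝ))
      (volume : Measure (ℝ × E n)) volume :=
    (MeasurePreserving.id _).prod (PiLp.volume_preserving_ofLp (Fin n))
  have m2 := (volume_preserving_piFinSuccAbove (fun _ : Fin (n + 1) => ℝ) 0).symm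
  have m3 := PiLp.volume_preserving_toLp (Fin (n + 1))
  have m4 := b.repr.symm.measurePreserving
  refine ⟨_, m4.comp (m3.comp (m2.comp m1)), fun p => ⟨?_, ?_⟩⟩
  · simp [EuclideanSpace.norm_sq_eq, Fin.sum_univ_succ]
  · rw [← hb0, ← b.repr.inner_map_map]
    simp [EuclideanSpace.inner_single_right]

theorem lintegral_hitRegion {n : ℕ} (hn : 1 ≤ n) {lam : ℝ} (hl : 0 ≤ lam) (h : ℝ) {v : E (n + 1)}
    (hv : ‖v‖ = 1) :
    ∫⁻ x in hitRegion lam h v, ENNReal.ofReal (pseudoTime lam x)⁻¹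
      = ENNReal.ofReal h * volume (ball (0 : E n) 1) := by
  have : Nontrivial (E n) := Module.nontrivial_of_finrank_pos (R := ℝ)
      (by rw [finrank_euclideanSpace_fin]; omega)
  obtain ⟨e, he, hep⟩ := exists_adapted_coordinates hv
  have hm := measurableSet_hitRegion lam h v
  have hpt : Measurable (pseudoTime (d := n + 1) lam) := by unfold pseudoTime; fun_prop
  have hem := he.measurable
  have hmem : ∀ p : ℝ × E n, e p ∈ hitRegion lam h v ↔ p.1 ∈ hitSlice lam h (‖p.2‖ ^ 2) := by
    intro p
    rw [hitRegion, hitSlice, mem_ofPred_eq, mem_ofPred_eq, pseudoTime, (hep p).1, (hep p).2,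
      ← (hep p).1, one_lt_sq_iff₀ (norm_nonneg _)]
  have hF : Measurable ((hitRegion lam h v).indicator
      fun x => ENNReal.ofReal (pseudoTime lam x)⁻¹) :=
    Measurable.indicator (by fun_prop) hm
  have hFe : Measurable fun p => (hitRegion lam h v).indicator
      (fun x => ENNReal.ofReal (pseudoTime lam x)⁻¹) (e p) := hF.comp hem
  rw [← lintegral_indicator hm, ← he.lintegral_comp hF, Measure.volume_eq_prod,
    lintegral_prod_symm _ hFe.aemeasurable]
  have hinner : ∀ w : E n, ∫⁻ a : ℝ, (hitRegion lam h v).indicator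
      (fun x => ENNReal.ofReal (pseudoTime lam x)⁻¹) (e (a, w))
      = ∫⁻ a in hitSlice lam h (‖w‖ ^ 2),
        ENNReal.ofReal (√(a ^ 2 + ‖w‖ ^ 2 - 1 + lam ^ 2))⁻¹ := by
    intro w
    have hms : MeasurableSet (hitSlice lam h (‖w‖ ^ 2)) := by
      have : hitSlice lam h (‖w‖ ^ 2) = (fun a : ℝ => e (a, w)) ⁻¹' hitRegion lam h v := by
        ext a
        exact (hmem (a, w)).symm
      rw [this]
      exact hm.preimage (by fun_prop)
    rw [← lintegral_indicator hms]
    refine lintegral_congr fun a => ?_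
    by_cases ha : a ∈ hitSlice lam h (‖w‖ ^ 2)
    · rw [indicator_of_mem ha, indicator_of_mem ((hmem (a, w)).2 ha), pseudoTime, (hep (a, w)).1]
    · rw [indicator_of_notMem ha, indicator_of_notMem (fun hx => ha ((hmem (a, w)).1 hx))]
  have hae : ∀ᵐ w : E n, ∫⁻ a : ℝ, (hitRegion lam h v).indicator
      (fun x => ENNReal.ofReal (pseudoTime lam x)⁻¹) (e (a, w))
      = (ball (0 : E n) 1).indicator (fun _ => ENNReal.ofReal h) w := by
    -- The case `‖w‖ = 1`, where `q = 0`, is not covered by the slice lemmas but is negligible.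
    have hnull : ∀ᵐ w : E n, w ∉ sphere (0 : E n) 1 :=
      measure_eq_zero_iff_ae_notMem.1 (Measure.addHaar_sphere _ _ _)
    filter_upwards [hnull] with w hw
    rw [mem_sphere_zero_iff_norm] at hw
    rw [hinner]
    rcases lt_or_gt_of_ne hw with hlt | hgt
    · rw [indicator_of_mem (by simpa using hlt), lintegral_hitSlice hl]
      nlinarith [norm_nonneg w]
    · rw [indicator_of_notMem (by simpa using hgt.le), hitSlice_eq_empty (by nlinarith)]
      simp
  rw [lintegral_congr_ae hae, lintegral_indicator measurableSet_ball, setLIntegral_const]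

/-! ### The constant and the conclusion -/

/-- The ratio of the volume of the unit ball in dimension `n` and the area of the unit sphere in
dimension `n + 1`. -/
theorem volume_ball_div_toSphere_univ {n : ℕ} (hn : 1 ≤ n) :
    ((volume : Measure (E (n + 1))).toSphere univ)⁻¹ * volume (ball (0 : E n) 1)
      = ENNReal.ofReal (Real.Gamma (((n + 1 : ℕ) : ℝ) / 2)
          / (2 * √Real.pi * Real.Gamma ((((n + 1 : ℕ) : ℝ) + 1) / 2))) := by
  have : Nonempty (Fin n) := ⟨⟨0, hn⟩⟩
  have hpi : 0 < √Real.pi := Real.sqrt_pos.2 Real.pi_pos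
  -- With `d = n + 1`, the area is `d` times the volume of the unit ball; the functional equation
  -- cancels this `d` and leaves `2 √π ^ d / Γ(d / 2)`.
  have hg : Real.Gamma (((n + 1 : ℕ) : ℝ) / 2 + 1)
      = ((n + 1 : ℕ) : ℝ) / 2 * Real.Gamma (((n + 1 : ℕ) : ℝ) / 2) :=
    Real.Gamma_add_one (by positivity)
  have hg1 : 0 < Real.Gamma (((n + 1 : ℕ) : ℝ) / 2) := Real.Gamma_pos_of_pos (by positivity)
  have hg2 : 0 < Real.Gamma ((n : ℝ) / 2 + 1) := Real.Gamma_pos_of_pos (by positivity)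
  rw [Measure.toSphere_apply_univ, finrank_euclideanSpace_fin, EuclideanSpace.volume_ball,
    EuclideanSpace.volume_ball, Fintype.card_fin, Fintype.card_fin, ENNReal.ofReal_one, one_pow,
    one_pow, one_mul, one_mul, hg, ← ENNReal.ofReal_natCast, ← ENNReal.ofReal_mul (by positivity),
    ← ENNReal.ofReal_inv_of_pos (by positivity), ← ENNReal.ofReal_mul (by positivity)]
  congr 1
  rw [show (((n + 1 : ℕ) : ℝ) + 1) / 2 = (n : ℝ) / 2 + 1 by push_cast; ring]
  generalize Real.Gamma (((n + 1 : ℕ) : ℝ) / 2) = G at *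
  generalize Real.Gamma ((n : ℝ) / 2 + 1) = G' at *
  have : (((n + 1 : ℕ) : ℝ)) ≠ 0 := by positivity
  generalize ((n + 1 : ℕ) : ℝ) = N at *
  rw [pow_succ]
  field_simp

theorem nuO_hitting {d : ℕ} (hd : 2 ≤ d) {lam : ℝ} (hl : lam ∈ Icc (0 : ℝ) 1) {h : ℝ}
    {y : E d} {ℓ : Set (E d)} (hℓ : IsGeodesicSegment 0 y h ℓ) :
    nuO hd hl (hitting lam ℓ) = ENNReal.ofReal (Real.Gamma ((d : ℝ) / 2)
      / (2 * √Real.pi * Real.Gamma (((d : ℝ) + 1) / 2))) * ENNReal.ofReal h := by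
  obtain ⟨hh, c, hc, hdist, h0, -, rfl⟩ := hℓ
  obtain ⟨v, hv, hcv⟩ := exists_direction hd hh hc hdist h0
  have hmeas : MeasurableSet (hitting lam (c '' Icc 0 h)) :=
    MeasurableSpace.measurableSet_generateFrom
      ⟨_, isCompact_geodesic hc hcv, image_subset_iff.2 hc, rfl⟩
  have hpre : hyperplane hd hl ⁻¹' hitting lam (c '' Icc 0 h)
      = {p : Ioi (0 : ℝ) × sphere (0 : E d) 1 |
        (Real.cosh p.1 + lam * Real.sinh p.1) • (p.2 : E d) ∈ hitRegion lam h v} := by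
    ext p
    exact hyperplane_mem_hitting_iff hd hl hc hcv p
  have hmp := measurable_hyperplane hd hl
  rw [nuO, Measure.map_apply hmp hmeas, withDensity_apply _ (hmp hmeas), hpre, sphereMeasure,
    Measure.prod_smul_right, Measure.restrict_smul, lintegral_smul_measure,
    lintegral_weight_hitRegion (by omega) hl.1]
  obtain ⟨n, rfl⟩ : ∃ n, d = n + 1 := ⟨d - 1, by omega⟩
  rw [lintegral_hitRegion (by omega) hl.1 h hv, smul_eq_mul, mul_left_comm,
    volume_ball_div_toSphere_univ (by omega), mul_comm]

end LambdaGeod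

theorem corollary4p6 {d : ℕ} (hd : 2 ≤ d) {lam : ℝ} (hl : lam ∈ Set.Icc (0 : ℝ) 1)
    {γ : ℝ} (hγ : 0 < γ) {h : ℝ} {y : LambdaGeod.E d} {ℓ : Set (LambdaGeod.E d)}
    (hℓ : LambdaGeod.IsGeodesicSegment 0 y h ℓ) :
    LambdaGeod.mu hd hl γ (LambdaGeod.hitting lam ℓ)
      = ENNReal.ofReal
          (γ * (Real.Gamma ((d : ℝ) / 2)
            / (2 * √Real.pi * Real.Gamma (((d : ℝ) + 1) / 2))) * h) := by
  have h1 : 0 < Real.Gamma ((d : ℝ) / 2) := Real.Gamma_pos_of_pos (by positivity)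
  have h2 : 0 < Real.Gamma (((d : ℝ) + 1) / 2) := Real.Gamma_pos_of_pos (by positivity)
  rw [LambdaGeod.mu, Measure.smul_apply, LambdaGeod.nuO_hitting hd hl hℓ, smul_eq_mul,
    ENNReal.ofReal_mul (by positivity), ENNReal.ofReal_mul hγ.le, mul_assoc (ENNReal.ofReal γ)]
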